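/- Let $(W,S)$ be a Coxeter system with $W$ finite and $S=\{s_1,\dots,s_n\}$, with length function $\ell$ and set of reflections $T=\{x^{-1}sx : s\in S,\ x\in W\}$. Write $g^w=w^{-1}gw$ and $A^w=w^{-1}Aw$ for $g,w\in W$, $A\subseteq W$. Let $W$ act on $\mathbb{R}^n$ by its reflection representation: $\mathbb{R}^n$ has basis $\alpha_1,\dots,\alpha_n$ and the (positive definite) invariant form $(\alpha_i,\alpha_j)=-\cos(\pi/m_{ij})$, where $m_{ij}$ is the order of $s_is_j$, and $s_i$ acts as $p\mapsto p-2(\alpha_i,p)\alpha_i$. For $t\in T$ let $H_t=\ker(t-1)$, and for $U\subseteq T$ let $E_U=\bigcap_{u\in U}H_u$. Let $C=\{p : (\alpha_i,p)>0 \text{ for all } i\}$ be the fundamental chamber and, for $x\in W$, let $C_x=Cx$ be its image under the right action $p\,x:=x^{-1}p$. For a subspace $E$ of $\mathbb{R}^n$ and $t\in T$ let $$L(E,t)=\{x\in W : \langle \overline{C}_x\cap H_t\rangle=E\},$$ where $\langle\cdot\rangle$ is the linear span. For $J\subseteq S$ let $W_J=\langle J\rangle$, $T_J=T\cap W_J$,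 let $X_J$ be the set of elements $x$ of minimal length in their coset $W_Jx$, let $[J]$ be the set of all $K\subseteq S$ that are $W$-conjugate to $J$, and let $X(S,J)=\{w\in X_J\cap X_J^{-1} : J^w=J\}$. The set $J$ is irreducible if it is nonempty and is not a disjoint union of two nonempty subsets commuting with one another elementwise. The support $J(x)$ of $x\in W$ is the set of simple reflections occurring in a reduced expression of $x$, and $\lfloor x\rceil$ is the set of conjugates $y$ of $x$ in $W$ with $J(y)=J(x)$. **Proposition.** Let $J\subseteq S$ be irreducible and let $t\in T$ have support $J(t)=J$. Let $s\in S$ and $v\in W$ be such that $s^v$ is a reduced expression of $t$, that is, $t=v^{-1}sv$ and $\ell(t)=2\ell(v)+1$. For each $K\in[J]$ let $c_{K,J}\in W$ be any element with $K^{c_{K,J}}=J$, and for each $u\in\lfloor t\rceil$ let $c_{u,t}\in W_J$ be any element with $u^{c_{u,t}}=t$. Then $$L(E_{T_J},t)=\bigsqcup_{K\in[J]}c_{K,J}\,X(S,J)\Big(\bigsqcup_{u\in\lfloor t\rceil}c_{u,t}\,N_{W_J}(W_{\{s\}})^v\Big),$$ where both unions are disjoint and $N_{W_J}(W_{\{s\}})$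 is the normalizer of $W_{\{s\}}$ in $W_J$. -/

import Mathlib

open scoped Pointwise

noncomputable section

namespace CoxArr

/-! ### Combinatorics of a Coxeter system `(W, S)` -/

section Group

variable {W : Type*} [Group W]

/-- The conjugate `g ^ w = w⁻¹ g w`. -/
def conj (g w : W) : W := w⁻¹ * g * w

/-- The conjugate `A ^ w = w⁻¹ A w` of a subset `A`. -/
def conjSet (A : Set W) (w : W) : Set W := (fun a => conj a w) '' A

/-- `N_H(K)`, the elements of `H` which normalize the subgroup `K`, as a subset of `W`. -/
def normalizerIn (H K : Subgroup W) : Set W :=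
  {g | g ∈ H ∧ g ∈ Subgroup.normalizer (K : Set W)}

end Group

section Coxeter

variable {B W : Type*} [Group W] {M : CoxeterMatrix B} (cs : CoxeterSystem M W)

/-- The set `S` of simple reflections. -/
def simples : Set W := Set.range cs.simple

/-- The parabolic subgroup `W_J = ⟨J⟩`, for `J ⊆ S`. -/
def parabolic (J : Set W) : Subgroup W := Subgroup.closure J

/-- `T_J = T ∩ W_J`, where `T` is the set of all reflections. -/
def reflectionsIn (J : Set W) : Set W := {t | cs.IsReflection t ∧ t ∈ parabolic J}

/-- `X_J`: the elements of minimal length in their coset `W_J x`. -/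
def minReps (J : Set W) : Set W :=
  {x | ∀ w ∈ parabolic J, cs.length x ≤ cs.length (w * x)}

/-- `X(J, K) = {w ∈ W_J ∩ X_K ∩ X_K⁻¹ | K ^ w = K}`. -/
def doubleReps (J K : Set W) : Set W :=
  {w | w ∈ parabolic J ∧ w ∈ minReps cs K ∧ w⁻¹ ∈ minReps cs K ∧ conjSet K w = K}

/-- The Coxeter class `[J]`: the `W`-conjugates of `J` which are subsets of `S`. -/
def coxeterClass (J : Set W) : Set (Set W) :=
  {K | K ⊆ simples cs ∧ ∃ w : W, conjSet K w = J}

/-- `J ⊆ S` is irreducible: it is nonempty and is not the union of two nonempty disjoint subsets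
commuting with one another elementwise. -/
def IsIrreducible (J : Set W) : Prop :=
  J.Nonempty ∧ ∀ A A' : Set W, A.Nonempty → A'.Nonempty → Disjoint A A' → A ∪ A' = J →
    ∃ a ∈ A, ∃ b ∈ A', a * b ≠ b * a

/-- The support `J(x)`: the simple reflections which occur in a reduced expression of `x`
(all reduced expressions of `x` involve the same simple reflections). -/
def support (x : W) : Set W :=
  {a | ∃ ω : List B, cs.IsReduced ω ∧ cs.wordProd ω = x ∧ ∃ i ∈ ω, a = cs.simple i}

/-- `⌊x⌉`: the conjugates of `x` which have the same support as `x`. -/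
def sameSupportConj (x : W) : Set W := {y | support cs y = support cs x ∧ IsConj y x}

/-- `s ^ v` is a reduced expression of `t`, with `s = cs.simple i`: for some expression
`v = s₁ ⋯ sₖ`, the word `sₖ ⋯ s₁ s s₁ ⋯ sₖ` is a reduced expression of `t`. -/
def IsReducedConjExpr (t : W) (i : B) (v : W) : Prop :=
  ∃ ω : List B, cs.wordProd ω = v ∧ cs.IsReduced (ω.reverse ++ i :: ω) ∧
    cs.wordProd (ω.reverse ++ i :: ω) = t

end Coxeter

/-! ### The reflection representation on `ℝⁿ = (B → ℝ)`, `n = |S|` -/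

section Geometry

variable {B : Type*} [Fintype B] [DecidableEq B] (M : CoxeterMatrix B)

/-- The invariant symmetric bilinear form, `(αᵢ, αⱼ) = -cos (π / mᵢⱼ)`; it is an inner product
when the Coxeter group is finite. -/
def form : LinearMap.BilinForm ℝ (B → ℝ) :=
  Matrix.toBilin' (Matrix.of fun i j => -Real.cos (Real.pi / M i j))

/-- The simple roots `αᵢ`, the standard basis vectors. -/
def simpleRoot (i : B) : B → ℝ := Pi.single i 1

theorem form_simpleRoot (i j : B) :
    form M (simpleRoot i) (simpleRoot j) = -Real.cos (Real.pi / M i j) := by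
  simp [form, simpleRoot, Matrix.toBilin'_single]

/-- The linear form `2 (αᵢ, ·)`. -/
def simpleCoroot (i : B) : Module.Dual ℝ (B → ℝ) := (2 : ℝ) • form M (simpleRoot i)

theorem simpleCoroot_simpleRoot (i j : B) :
    simpleCoroot M i (simpleRoot j) = -2 * Real.cos (Real.pi / M i j) := by
  simp [simpleCoroot, form_simpleRoot]

theorem simpleCoroot_self (i : B) : simpleCoroot M i (simpleRoot i) = 2 := by
  simp [simpleCoroot_simpleRoot]

/-- The reflection `x ↦ x - 2 (αᵢ, x) αᵢ`. -/
def simpleRefl (i : B) : (B → ℝ) ≃ₗ[ℝ] (B → ℝ) := Module.reflection (simpleCoroot_self M i)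

theorem simpleRefl_isLiftable : M.IsLiftable (simpleRefl M) := by
  intro i j
  have ha : simpleCoroot M i (simpleRoot j) = -2 * Real.cos (Real.pi / M i j) :=
    simpleCoroot_simpleRoot M i j
  have hb : simpleCoroot M j (simpleRoot i) = -2 * Real.cos (Real.pi / M i j) := by
    rw [simpleCoroot_simpleRoot, M.symmetric j i]
  by_cases hij : i = j
  · subst hij
    refine LinearEquiv.ext fun z => ?_
    rw [M.diagonal i, pow_one]
    exact Module.involutive_reflection (simpleCoroot_self M i) z
  have h1 : M i j ≠ 1 := M.off_diagonal i j hij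
  refine LinearEquiv.ext fun z => ?_
  rcases Nat.eq_zero_or_pos (M i j) with h0 | hpos
  · simp [h0]
  set m := M i j with hm
  rw [simpleRefl, simpleRefl, Module.reflection_mul_reflection_pow_apply
    (simpleCoroot_self M i) (simpleCoroot_self M j) m z
    (2 * Real.cos (2 * (Real.pi / m))) (by rw [ha, hb, Real.cos_two_mul]; ring)]
  have hm0 : (m : ℝ) ≠ 0 := by exact_mod_cast hpos.ne'
  by_cases h2 : m = 2
  · rw [ha, hb]
    have e : 2 * (Real.pi / (2 : ℕ)) = Real.pi := by push_cast; ring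
    have e' : Real.pi / (2 : ℕ) = Real.pi / 2 := by push_cast; ring
    rw [h2, e, e']
    norm_num
    module
  have h3 : 3 ≤ m := by omega
  have hsin : Real.sin (2 * (Real.pi / m)) ≠ 0 := by
    refine (Real.sin_pos_of_pos_of_lt_pi (by positivity) ?_).ne'
    have : (3 : ℝ) ≤ m := by exact_mod_cast h3
    rw [← mul_div_assoc, div_lt_iff₀ (by positivity)]
    nlinarith [Real.pi_pos]
  have hS := fun k : ℤ => Polynomial.Chebyshev.S_two_mul_real_cos (2 * (Real.pi / m)) k
  obtain ⟨k, hk | hk⟩ := Nat.even_or_odd' m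
  · have hz : (Polynomial.Chebyshev.S ℝ ((k : ℤ) - 1)).eval
        (2 * Real.cos (2 * (Real.pi / m))) = 0 := by
      refine (mul_eq_zero.mp ?_).resolve_right hsin
      rw [hS, hk, ← Real.sin_pi]
      congr 1
      have : (k : ℝ) ≠ 0 := by rintro h; simp_all
      push_cast
      field_simp
      ring
    have e1 : ((m : ℤ) - 2) / 2 = k - 1 := by omega
    have e2 : ((m : ℤ) - 1) / 2 = k - 1 := by omega
    rw [e1, e2, hz]
    simp
  · have hz : (Polynomial.Chebyshev.S ℝ (k : ℤ)).eval (2 * Real.cos (2 * (Real.pi / m))) +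
        (Polynomial.Chebyshev.S ℝ ((k : ℤ) - 1)).eval
          (2 * Real.cos (2 * (Real.pi / m))) = 0 := by
      refine (mul_eq_zero.mp ?_).resolve_right hsin
      rw [add_mul, hS, hS]
      have : (((k : ℤ) : ℝ) + 1) * (2 * (Real.pi / m)) =
          2 * Real.pi - (((k - 1 : ℤ) : ℝ) + 1) * (2 * (Real.pi / m)) := by
        rw [hk]
        push_cast
        field_simp
        ring
      rw [this, Real.sin_two_pi_sub]
      ring
    have e1 : ((m : ℤ) - 2) / 2 = k - 1 := by omega
    have e2 : ((m : ℤ) - 1) / 2 = k := by omega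
    have e3 : ((m : ℤ) - 3) / 2 = k - 1 := by omega
    have e4 : (m : ℤ) / 2 = k := by omega
    rw [e1, e2, e3, e4, hz]
    simp

variable {M} {W : Type*} [Group W] (cs : CoxeterSystem M W)

/-- The reflection representation of `W` on `ℝⁿ`, sending `cs.simple i` to the reflection
orthogonal to `αᵢ`. -/
def rep : W →* ((B → ℝ) ≃ₗ[ℝ] (B → ℝ)) := cs.lift ⟨simpleRefl M, simpleRefl_isLiftable M⟩

/-- `H_t = ker (t - 1)`. -/
def hyperplane (t : W) : Submodule ℝ (B → ℝ) :=
  LinearMap.ker ((rep cs t : (B → ℝ) →ₗ[ℝ] (B → ℝ)) - LinearMap.id)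

/-- `E_U`, the intersection of the `H_u`, `u ∈ U`. -/
def edge (U : Set W) : Submodule ℝ (B → ℝ) := ⨅ u ∈ U, hyperplane cs u

variable (M) in
/-- The chamber `C` of the identity: the open cone bounded by the hyperplanes of the simple
reflections. -/
def fundamentalChamber : Set (B → ℝ) := {p | ∀ i, 0 < form M (simpleRoot i) p}

/-- The chamber `C_x = C x`, where `W` acts from the right on `ℝⁿ` by `p x = x⁻¹ p`. -/
def chamber (x : W) : Set (B → ℝ) := rep cs x⁻¹ '' fundamentalChamber M

/-- `L(E, t)`: the `x ∈ W` such that the closed face `closure C_x ∩ H_t` spans `E`. -/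
def chambersSpanning (E : Submodule ℝ (B → ℝ)) (t : W) : Set W :=
  {x | Submodule.span ℝ (closure (chamber cs x) ∩ (hyperplane cs t : Set (B → ℝ))) = E}

end Geometry

end CoxArr

end

/-! A point of the closed fundamental chamber fixed by `r` is fixed by every letter of a reduced
word of `r`. So `H_r` meets that chamber in the face cut out by `E_K`, `K = J(r)`, and this face
spans `E_K`. Translating by `x`, membership of `x` in `L(E_{T_J}, t)` says that `x` carries `E_J` to
`E_K` with `K = J(x t x⁻¹)`. As `W_K` is the pointwise stabilizer of `E_K` and `E_K` its fixed
space, this means `x W_J x⁻¹ = W_K` (`mem_chambersSpanning_iff`).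

A shortest element of `x W_J` then conjugates `J` to `K` (`exists_minimal_conjugator`), so `K ∈
[J]`. The element `c_K⁻¹ x` normalizes `W_J` and factors as `w y` with `w ∈ X(S,J)`, `y ∈ W_J`.
Conjugation by `c_K` and `w` preserves full support, so the remaining condition is `J(y t y⁻¹) = J`.
Sorting the `y` by `u = y t y⁻¹` gives cosets of the centralizer of `t` in `W_J`, which is
`N_{W_J}(W_{s})^v`. Disjointness holds because `x` determines `K` and `y` determines `u`. -/

noncomputable section

namespace CoxArr

/-! ### Alternating suffixes and supports of words -/

section Words

variable {B : Type*} {M : CoxeterMatrix B} {W : Type*} [Group W] (cs : CoxeterSystem M W)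

/-- Splitting off a maximal alternating suffix in `sᵢ`, `sⱼ`. -/
theorem exists_eq_mul_alternatingWord (n : ℕ) : ∀ (w : W) (i j : B), cs.length w = n →
    ¬ cs.IsRightDescent w i → ∃ v k, w = v * cs.wordProd (CoxeterSystem.alternatingWord i j k) ∧
      cs.length w = cs.length v + k ∧ ¬ cs.IsRightDescent v i ∧ ¬ cs.IsRightDescent v j := by
  induction n with
  | zero =>
    intro w i j hw _
    obtain rfl := cs.length_eq_zero_iff.mp hw
    exact ⟨1, 0, by simp [CoxeterSystem.alternatingWord], by simp,
      cs.not_isRightDescent_one i, cs.not_isRightDescent_one j⟩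
  | succ n ih =>
    intro w i j hw hi
    by_cases hj : cs.IsRightDescent w j
    · have hl := cs.isRightDescent_iff.mp hj
      -- The roles of `i` and `j` swap because the alternating word for `i j` ends in `j`.
      obtain ⟨v, k, hvk, hlen, hvj, hvi⟩ := ih (w * cs.simple j) j i (by omega)
        (cs.isRightDescent_iff_not_isRightDescent_mul.mp hj)
      refine ⟨v, k + 1, ?_, by omega, hvi, hvj⟩
      rw [CoxeterSystem.alternatingWord_succ, cs.wordProd_concat, ← mul_assoc, ← hvk,
        cs.simple_mul_simple_cancel_right]
    · exact ⟨w, 0, by simp [CoxeterSystem.alternatingWord], by simp, hi, hj⟩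

theorem support_subset_simples (x : W) : support cs x ⊆ simples cs := by
  rintro _ ⟨ω, -, -, i, -, rfl⟩
  exact ⟨i, rfl⟩

theorem mem_parabolic_support (x : W) : x ∈ parabolic (support cs x) := by
  obtain ⟨ω, hω, hx⟩ := cs.exists_isReduced x
  rw [hx, CoxeterSystem.wordProd]
  refine Subgroup.list_prod_mem _ fun a ha => Subgroup.subset_closure ?_
  obtain ⟨i, hi, rfl⟩ := List.mem_map.mp ha
  exact ⟨ω, hω, rfl, i, hi, rfl⟩

end Words

theorem simpleRoot_ne_zero {B : Type*} [DecidableEq B] (i : B) : simpleRoot i ≠ 0 := by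
  simp [simpleRoot]

theorem simpleRoot_nonneg {B : Type*} [DecidableEq B] (i : B) : 0 ≤ simpleRoot i := by
  simp [simpleRoot]

/-! ### Signs of roots and nondegeneracy of the form -/

section Representation

variable {B : Type*} [Fintype B] [DecidableEq B] (M : CoxeterMatrix B)

theorem form_self (i : B) : form M (simpleRoot i) (simpleRoot i) = 1 := by
  simp [form_simpleRoot]

theorem eq_sum_smul_simpleRoot (x : B → ℝ) : x = ∑ i, x i • simpleRoot i := by
  ext j
  simp [simpleRoot, Finset.sum_apply, Pi.single_apply]

theorem form_eq_sum (x y : B → ℝ) : form M x y = ∑ i, x i * form M (simpleRoot i) y := by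
  conv_lhs => rw [eq_sum_smul_simpleRoot x]
  simp [LinearMap.sum_apply]

theorem form_comm (x y : B → ℝ) : form M x y = form M y x := by
  have h : ∀ i, form M (simpleRoot i) y = form M y (simpleRoot i) := by
    intro i
    rw [form_eq_sum M y]
    conv_lhs => rw [eq_sum_smul_simpleRoot y]
    simp [map_sum, form_simpleRoot, M.symmetric i]
  rw [form_eq_sum]
  conv_rhs => rw [eq_sum_smul_simpleRoot x]
  simp [map_sum, h]

variable {M} {W : Type*} [Group W] (cs : CoxeterSystem M W)

theorem rep_simple (i : B) (x : B → ℝ) :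
    rep cs (cs.simple i) x = x - (2 * form M (simpleRoot i) x) • simpleRoot i := by
  simp [rep, CoxeterSystem.lift_apply_simple, simpleRefl, Module.reflection_apply, simpleCoroot]

theorem rep_mul (v w : W) (x : B → ℝ) : rep cs (v * w) x = rep cs v (rep cs w x) := by
  rw [map_mul]; rfl

theorem rep_one (x : B → ℝ) : rep cs 1 x = x := by
  rw [map_one]; rfl

theorem rep_inv_rep (w : W) (x : B → ℝ) : rep cs w⁻¹ (rep cs w x) = x := by
  rw [← rep_mul, inv_mul_cancel, rep_one]

theorem rep_rep_inv (w : W) (x : B → ℝ) : rep cs w (rep cs w⁻¹ x) = x := by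
  rw [← rep_mul, mul_inv_cancel, rep_one]

theorem rep_simple_self (i : B) : rep cs (cs.simple i) (simpleRoot i) = -simpleRoot i := by
  rw [rep_simple, form_self]; module

theorem rep_simple_eq_self_iff (i : B) (x : B → ℝ) :
    rep cs (cs.simple i) x = x ↔ form M (simpleRoot i) x = 0 := by
  rw [rep_simple, sub_eq_self, smul_eq_zero]
  simp [simpleRoot_ne_zero]

theorem form_rep (w : W) : ∀ x y, form M (rep cs w x) (rep cs w y) = form M x y := by
  induction w using cs.simple_induction_left with
  | one => simp
  | mul_simple_left w i ih =>
    intro x y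
    rw [rep_mul, rep_mul, ← ih x y, rep_simple, rep_simple]
    simp only [map_sub, map_smul, LinearMap.sub_apply, LinearMap.smul_apply, smul_eq_mul,
      form_self]
    rw [form_comm M (rep cs w x) (simpleRoot i)]
    ring

theorem form_rep_left (w : W) (x y : B → ℝ) :
    form M (rep cs w x) y = form M x (rep cs w⁻¹ y) := by
  rw [← form_rep cs w x, rep_rep_inv]

/-- The coefficients of the roots of a dihedral group with angle `π / m`. -/
theorem exists_dihedral_coeff (m : ℕ) (hm : m ≠ 1) : ∃ a : ℕ → ℝ, a 0 = 0 ∧ a 1 = 1 ∧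
    (∀ k, a (k + 2) = 2 * Real.cos (Real.pi / m) * a (k + 1) - a k) ∧
    ∀ k, (m ≠ 0 → k ≤ m) → 0 ≤ a k := by
  rcases Nat.eq_zero_or_pos m with rfl | hpos
  -- Here `π / 0 = 0` in Lean, so the cosine is `1` and the recurrence is that of an arithmetic
  -- progression.
  · refine ⟨fun k => k, by simp, by simp, fun k => ?_, fun k _ => by positivity⟩
    push_cast
    simp
    ring
  have h2 : (2 : ℝ) ≤ m := by exact_mod_cast (by omega : 2 ≤ m)
  have hsin : 0 < Real.sin (Real.pi / m) := by
    refine Real.sin_pos_of_pos_of_lt_pi (by positivity) ?_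
    rw [div_lt_iff₀ (by positivity)]
    nlinarith [Real.pi_pos]
  -- The recurrence is the addition formula for sine; nonnegativity lasts while `k π / m ≤ π`.
  refine ⟨fun k => Real.sin (k * (Real.pi / m)) / Real.sin (Real.pi / m), by simp,
    by simp [hsin.ne'], fun k => ?_, fun k hk => div_nonneg ?_ hsin.le⟩
  · have e1 : ((k + 2 : ℕ) : ℝ) * (Real.pi / m) = ((k + 1 : ℕ) : ℝ) * (Real.pi / m) +
      Real.pi / m := by push_cast; ring
    have e2 : (k : ℝ) * (Real.pi / m) = ((k + 1 : ℕ) : ℝ) * (Real.pi / m) -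
      Real.pi / m := by push_cast; ring
    simp only
    rw [e1, e2, Real.sin_add, Real.sin_sub]
    field_simp
    ring
  · refine Real.sin_nonneg_of_nonneg_of_le_pi (by positivity) ?_
    have : (k : ℝ) ≤ m := by exact_mod_cast hk hpos.ne'
    rw [mul_div_assoc', div_le_iff₀ (by positivity)]
    nlinarith [Real.pi_pos]

/-- Prepending a letter changes one coordinate only, by the recurrence; the parity of `k` decides
which letter comes next. -/
theorem rep_alternatingWord {a : ℕ → ℝ} (h0 : a 0 = 0) (h1 : a 1 = 1) {i j : B}
    (ha : ∀ k, a (k + 2) = 2 * Real.cos (Real.pi / M i j) * a (k + 1) - a k) (k : ℕ) :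
    rep cs (cs.wordProd (CoxeterSystem.alternatingWord i j k)) (simpleRoot i) =
      if Even k then a (k + 1) • simpleRoot i + a k • simpleRoot j
      else a k • simpleRoot i + a (k + 1) • simpleRoot j := by
  induction k with
  | zero => simp [CoxeterSystem.alternatingWord, h0, h1]
  | succ k ih =>
    rw [CoxeterSystem.alternatingWord_succ', cs.wordProd_cons, rep_mul, ih]
    by_cases hk : Even k
    · have hk' : ¬ Even (k + 1) := by simpa [Nat.even_add_one] using hk
      simp only [hk, hk', if_true, if_false, rep_simple, map_add, map_smul, form_simpleRoot,
        M.diagonal, M.symmetric j i, ha]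
      simp
      module
    · have hk' : Even (k + 1) := by simpa [Nat.even_add_one] using hk
      simp only [hk, hk', if_true, if_false, rep_simple, map_add, map_smul, form_simpleRoot,
        M.diagonal, ha]
      simp
      module

/-- Induction on length. With `j` a right descent of `w`, write `w = v d`, where `d` is alternating
in `sᵢ`, `sⱼ` and `v` has neither as a descent. Then `d αᵢ` is a nonnegative combination of `αᵢ`,
`αⱼ`, and the shorter `v` keeps both nonnegative. -/
theorem rep_simpleRoot_nonneg {w : W} {i : B} (h : ¬ cs.IsRightDescent w i) :
    0 ≤ rep cs w (simpleRoot i) := by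
  induction hn : cs.length w using Nat.strong_induction_on generalizing w i with
  | _ n ih =>
    subst hn
    by_cases hw : w = 1
    · subst hw
      rw [rep_one]
      exact simpleRoot_nonneg i
    obtain ⟨j, hj⟩ := cs.exists_rightDescent_of_ne_one hw
    have hij : i ≠ j := by rintro rfl; exact h hj
    obtain ⟨v, k, hvk, hlen, hvi, hvj⟩ := exists_eq_mul_alternatingWord cs _ w i j rfl h
    have hk : k ≠ 0 := by
      rintro rfl
      apply hvj
      simpa [CoxeterSystem.alternatingWord, hvk] using hj
    obtain ⟨a, h0, h1, ha, hpos⟩ := exists_dihedral_coeff (M i j) (M.off_diagonal i j hij)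
    -- Since `w sᵢ` has length `ℓ(v) + k + 1`, its alternating suffix of `k + 1` letters must be
    -- reduced, which bounds `k + 1` by `M i j` when that is nonzero.
    have hred : cs.IsReduced (CoxeterSystem.alternatingWord j i (k + 1)) := by
      have hle := cs.length_mul_le v (cs.wordProd (CoxeterSystem.alternatingWord j i (k + 1)))
      have hle' := cs.length_wordProd_le (CoxeterSystem.alternatingWord j i (k + 1))
      rw [CoxeterSystem.alternatingWord_succ, cs.wordProd_concat, ← mul_assoc, ← hvk,
        ← cs.wordProd_concat, ← CoxeterSystem.alternatingWord_succ] at hle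
      rw [cs.not_isRightDescent_iff.mp h] at hle
      rw [CoxeterSystem.length_alternatingWord] at hle'
      rw [CoxeterSystem.IsReduced, CoxeterSystem.length_alternatingWord]
      omega
    have hkm : M i j ≠ 0 → k + 1 ≤ M i j := by
      intro hm
      by_contra hlt
      rw [M.symmetric] at hm hlt
      exact cs.not_isReduced_alternatingWord j i hm (by omega) hred
    have hak := hpos k fun hm => (Nat.le_succ k).trans (hkm hm)
    have hak' := hpos (k + 1) hkm
    have hri := ih _ (by omega) hvi rfl
    have hrj := ih _ (by omega) hvj rfl
    rw [hvk, rep_mul, rep_alternatingWord cs h0 h1 ha]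
    split_ifs
    all_goals
      rw [map_add, map_smul, map_smul]
      exact add_nonneg (smul_nonneg (by assumption) hri) (smul_nonneg (by assumption) hrj)

theorem rep_simpleRoot_nonpos {w : W} {i : B} (h : cs.IsRightDescent w i) :
    rep cs w (simpleRoot i) ≤ 0 := by
  have := rep_simpleRoot_nonneg cs (cs.isRightDescent_iff_not_isRightDescent_mul.mp h)
  rw [rep_mul, rep_simple_self, map_neg] at this
  simpa using this

theorem rep_injective : Function.Injective (rep cs) := by
  rw [injective_iff_map_eq_one]
  intro w hw
  by_contra hne
  obtain ⟨i, hi⟩ := cs.exists_rightDescent_of_ne_one hne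
  have := rep_simpleRoot_nonpos cs hi i
  rw [hw] at this
  simp [simpleRoot] at this
  linarith

/-- If `w` fixes `p` and `i` is its last letter, then `(αᵢ, p) = (w αᵢ, p) ≤ 0` because `w αᵢ ≤ 0`.
So `sᵢ` fixes `p`, and the word without its last letter still does. -/
theorem form_eq_zero_of_mem_reduced {p : B → ℝ} (hp : ∀ i, 0 ≤ form M (simpleRoot i) p)
    (ω : List B) (hω : cs.IsReduced ω) (hfix : rep cs (cs.wordProd ω) p = p) :
    ∀ i ∈ ω, form M (simpleRoot i) p = 0 := by
  induction ω using List.reverseRecOn with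
  | nil => simp
  | append_singleton ω i ih =>
    have hω' : cs.IsReduced ω := by simpa using hω.take ω.length
    have hprod : cs.wordProd (ω ++ [i]) = cs.wordProd ω * cs.simple i := by
      simp [cs.wordProd_append]
    have hdesc : cs.IsRightDescent (cs.wordProd (ω ++ [i])) i := by
      rw [cs.isRightDescent_iff, hω.eq, hprod, cs.simple_mul_simple_cancel_right, hω'.eq]
      simp
    have hneg := rep_simpleRoot_nonpos cs hdesc
    have hle : form M (simpleRoot i) p ≤ 0 := by
      rw [← form_rep cs (cs.wordProd (ω ++ [i])), hfix, form_eq_sum]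
      exact Finset.sum_nonpos fun j _ => mul_nonpos_of_nonpos_of_nonneg (hneg j) (hp j)
    have hi : form M (simpleRoot i) p = 0 := le_antisymm hle (hp i)
    rw [hprod, rep_mul, (rep_simple_eq_self_iff cs i p).mpr hi] at hfix
    intro j hj
    rcases List.mem_append.mp hj with hj | hj
    · exact ih hω' hfix j hj
    · rw [List.mem_singleton.mp hj, hi]

variable [Finite W]

/-- Averaging over `W` kills every `αᵢ`, since right translation by `sᵢ` negates the sum, and hence
every vector. A vector orthogonal to all `αᵢ` is fixed by `W`, so its sum over `W` is `|W|` times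
itself. -/
theorem eq_zero_of_form_eq_zero (cs : CoxeterSystem M W) {r : B → ℝ}
    (hr : ∀ i, form M (simpleRoot i) r = 0) : r = 0 := by
  cases nonempty_fintype W
  have hroot : ∀ i, ∑ w : W, rep cs w (simpleRoot i) = 0 := by
    intro i
    have h : ∑ w : W, rep cs w (simpleRoot i) = ∑ w : W, rep cs (w * cs.simple i) (simpleRoot i) :=
      (Equiv.sum_comp (Equiv.mulRight (cs.simple i)) fun w => rep cs w (simpleRoot i)).symm
    simp only [rep_mul, rep_simple_self, map_neg, Finset.sum_neg_distrib] at h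
    exact self_eq_neg.mp h
  have hfix : ∀ w : W, rep cs w r = r := by
    intro w
    induction w using cs.simple_induction_left with
    | one => exact rep_one cs r
    | mul_simple_left w i ih => rw [rep_mul, ih, rep_simple_eq_self_iff, hr]
  have h0 : ∑ w : W, rep cs w r = 0 := by
    rw [eq_sum_smul_simpleRoot r]
    simp only [map_sum, map_smul]
    rw [Finset.sum_comm]
    simp [← Finset.smul_sum, hroot]
  simp only [hfix, Finset.sum_const, Finset.card_univ] at h0
  exact (smul_eq_zero.mp h0).resolve_left Fintype.card_ne_zero

theorem exists_form_eq (cs : CoxeterSystem M W) (f : B → ℝ) :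
    ∃ p, ∀ i, form M (simpleRoot i) p = f i := by
  let φ : (B → ℝ) →ₗ[ℝ] (B → ℝ) := LinearMap.pi fun i => form M (simpleRoot i)
  have hφ : Function.Injective φ := by
    rw [injective_iff_map_eq_zero]
    exact fun r hr => eq_zero_of_form_eq_zero cs fun i => congrFun hr i
  obtain ⟨p, hp⟩ := LinearMap.injective_iff_surjective.mp hφ f
  exact ⟨p, fun i => congrFun hp i⟩

/-- A point of the closed fundamental chamber lying on exactly the walls in `K`. -/
theorem exists_wall_point (K : Set W) : ∃ p : B → ℝ, (∀ i, 0 ≤ form M (simpleRoot i) p) ∧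
    ∀ i, form M (simpleRoot i) p = 0 ↔ cs.simple i ∈ K := by
  classical
  obtain ⟨p, hp⟩ := exists_form_eq cs fun i => if cs.simple i ∈ K then 0 else 1
  refine ⟨p, fun i => ?_, fun i => ?_⟩ <;> rw [hp] <;> split_ifs <;> simp_all

end Representation

/-! ### Parabolic subgroups as pointwise stabilizers -/

section Parabolic

variable {B : Type*} [Fintype B] [DecidableEq B] {M : CoxeterMatrix B} {W : Type*} [Group W]
  (cs : CoxeterSystem M W)

theorem mem_hyperplane {t : W} {p : B → ℝ} : p ∈ hyperplane cs t ↔ rep cs t p = p := by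
  simp [hyperplane, sub_eq_zero]

theorem mem_edge {U : Set W} {p : B → ℝ} : p ∈ edge cs U ↔ ∀ u ∈ U, rep cs u p = p := by
  simp [edge, mem_hyperplane]

theorem rep_eq_self_of_mem_parabolic {K : Set W} {p : B → ℝ} (hp : p ∈ edge cs K) {w : W}
    (hw : w ∈ parabolic K) : rep cs w p = p := by
  rw [mem_edge] at hp
  induction hw using Subgroup.closure_induction with
  | mem x hx => exact hp x hx
  | one => exact rep_one cs p
  | mul x y _ _ hx hy => rw [rep_mul, hy, hx]
  | inv x _ hx => rw [← hx, rep_inv_rep, hx]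

theorem edge_reflectionsIn {J : Set W} (hJ : J ⊆ simples cs) :
    edge cs (reflectionsIn cs J) = edge cs J := by
  ext p
  refine ⟨fun hp => ?_, fun hp => ?_⟩
  · rw [mem_edge] at hp ⊢
    intro u hu
    obtain ⟨i, rfl⟩ := hJ hu
    exact hp _ ⟨cs.isReflection_simple i, Subgroup.subset_closure hu⟩
  · exact (mem_edge cs).mpr fun u hu => rep_eq_self_of_mem_parabolic cs hp hu.2

theorem mem_edge_iff_form {K : Set W} (hK : K ⊆ simples cs) {p : B → ℝ} :
    p ∈ edge cs K ↔ ∀ i, cs.simple i ∈ K → form M (simpleRoot i) p = 0 := by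
  rw [mem_edge]
  refine ⟨fun h i hi => (rep_simple_eq_self_iff cs i p).mp (h _ hi), fun h u hu => ?_⟩
  obtain ⟨i, rfl⟩ := hK hu
  exact (rep_simple_eq_self_iff cs i p).mpr (h i hu)

/-- Elements of `W_K` do not change the coordinates outside `K`. -/
theorem rep_apply_of_notMem {K : Set W} (hK : K ⊆ simples cs) {w : W} (hw : w ∈ parabolic K)
    {k : B} (hk : cs.simple k ∉ K) (x : B → ℝ) : rep cs w x k = x k := by
  induction hw using Subgroup.closure_induction generalizing x with
  | mem g hg =>
    obtain ⟨i, rfl⟩ := hK hg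
    have hki : k ≠ i := by rintro rfl; exact hk hg
    simp [rep_simple, simpleRoot, hki]
  | one => rw [rep_one]
  | mul g h _ _ hg hh => rw [rep_mul, hg, hh]
  | inv g _ hg => rw [← hg (rep cs g⁻¹ x), rep_rep_inv]

theorem support_subset_of_rep_eq {p : B → ℝ} (hp : ∀ i, 0 ≤ form M (simpleRoot i) p) {x : W}
    (hx : rep cs x p = p) : ∀ a ∈ support cs x, rep cs a p = p := by
  rintro _ ⟨ω, hω, rfl, i, hi, rfl⟩
  exact (rep_simple_eq_self_iff cs i p).mpr (form_eq_zero_of_mem_reduced cs hp ω hω hx i hi)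

theorem closure_chamber (x : W) :
    closure (chamber cs x) = rep cs x⁻¹ '' closure (fundamentalChamber M) :=
  ((rep cs x⁻¹).toContinuousLinearEquiv.toHomeomorph.image_closure _).symm

variable [Finite W]

/-- It suffices to test `x` on one point of the closed chamber lying on exactly the walls in `K`. -/
theorem support_subset_of_forall_rep_eq {K : Set W} (hK : K ⊆ simples cs) {x : W}
    (h : ∀ p ∈ edge cs K, rep cs x p = p) : support cs x ⊆ K := by
  obtain ⟨p, hp, hpK⟩ := exists_wall_point cs K
  have hx : rep cs x p = p := h p ((mem_edge_iff_form cs hK).mpr fun i hi => (hpK i).mpr hi)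
  intro a ha
  obtain ⟨i, rfl⟩ := support_subset_simples cs x ha
  exact (hpK i).mp ((rep_simple_eq_self_iff cs i p).mp (support_subset_of_rep_eq cs hp hx _ ha))

theorem support_subset_iff {K : Set W} (hK : K ⊆ simples cs) {x : W} :
    support cs x ⊆ K ↔ x ∈ parabolic K :=
  ⟨fun h => Subgroup.closure_mono h (mem_parabolic_support cs x),
    fun h => support_subset_of_forall_rep_eq cs hK
      fun _ hp => rep_eq_self_of_mem_parabolic cs hp h⟩

/-- `W_K` is the pointwise stabilizer of `E_K`. -/
theorem mem_parabolic_iff {K : Set W} (hK : K ⊆ simples cs) {x : W} :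
    x ∈ parabolic K ↔ ∀ p ∈ edge cs K, rep cs x p = p :=
  ⟨fun h _ hp => rep_eq_self_of_mem_parabolic cs hp h,
    fun h => (support_subset_iff cs hK).mp (support_subset_of_forall_rep_eq cs hK h)⟩

end Parabolic

/-! ### Closed faces and their spans -/

section Chambers

variable {B : Type*} [Fintype B] [DecidableEq B] {M : CoxeterMatrix B} {W : Type*} [Group W]
  [Finite W] (cs : CoxeterSystem M W)

theorem mem_closure_fundamentalChamber (cs : CoxeterSystem M W) {p : B → ℝ} :
    p ∈ closure (fundamentalChamber M) ↔ ∀ i, 0 ≤ form M (simpleRoot i) p := by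
  have hcont : ∀ i, Continuous fun q => form M (simpleRoot i) q := fun i =>
    LinearMap.continuous_of_finiteDimensional (form M (simpleRoot i))
  refine ⟨fun hp i => ?_, fun hp => ?_⟩
  · have hcl : IsClosed {q : B → ℝ | 0 ≤ form M (simpleRoot i) q} :=
      isClosed_le continuous_const (hcont i)
    exact closure_minimal (fun q hq => (hq i).le) hcl hp
  -- Moving from `p` in the direction of the interior point `q` enters the open chamber at once.
  · obtain ⟨q, hq⟩ := exists_form_eq cs fun _ => 1
    have hlim : Filter.Tendsto (fun ε : ℝ => p + ε • q) (nhdsWithin 0 (Set.Ioi 0)) (nhds p) := by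
      have : Continuous fun ε : ℝ => p + ε • q := by fun_prop
      simpa using (this.tendsto 0).mono_left nhdsWithin_le_nhds
    refine mem_closure_of_tendsto hlim ?_
    filter_upwards [self_mem_nhdsWithin] with ε hε i
    have : 0 < ε := hε
    simpa [hq] using add_pos_of_nonneg_of_pos (hp i) this

theorem closure_inter_hyperplane (r : W) :
    closure (fundamentalChamber M) ∩ hyperplane cs r =
      closure (fundamentalChamber M) ∩ (edge cs (support cs r) : Set (B → ℝ)) := by
  ext p
  refine and_congr_right fun hp => ?_
  rw [mem_closure_fundamentalChamber cs] at hp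
  rw [SetLike.mem_coe, SetLike.mem_coe, mem_hyperplane]
  exact ⟨fun h => (mem_edge cs).mpr (support_subset_of_rep_eq cs hp h),
    fun h => rep_eq_self_of_mem_parabolic cs h (mem_parabolic_support cs r)⟩

/-- With `p` a relative interior point of the face, any `q` in `E_K` is the difference of `q + c p`
and `c p`, both in the face for large `c`. -/
theorem span_closure_inter_edge {K : Set W} (hK : K ⊆ simples cs) :
    Submodule.span ℝ (closure (fundamentalChamber M) ∩ (edge cs K : Set (B → ℝ))) =
      edge cs K := by
  refine le_antisymm (Submodule.span_le.mpr Set.inter_subset_right) fun q hq => ?_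
  obtain ⟨p, hp, hpK⟩ := exists_wall_point cs K
  have hpE : p ∈ edge cs K := (mem_edge_iff_form cs hK).mpr fun i hi => (hpK i).mpr hi
  have hq0 := (mem_edge_iff_form cs hK).mp hq
  -- The sum dominates every ratio needed; the terms with `i` in `K` are divisions by zero and
  -- contribute `0`.
  set c : ℝ := ∑ i, |form M (simpleRoot i) q / form M (simpleRoot i) p| with hc
  have hmem : q + c • p ∈ closure (fundamentalChamber M) := by
    rw [mem_closure_fundamentalChamber cs]
    intro i
    rw [map_add, map_smul, smul_eq_mul]
    by_cases hi : cs.simple i ∈ K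
    · rw [hq0 i hi, (hpK i).mpr hi]; simp
    have hpos : 0 < form M (simpleRoot i) p :=
      lt_of_le_of_ne (hp i) fun h => hi ((hpK i).mp h.symm)
    have hle : |form M (simpleRoot i) q / form M (simpleRoot i) p| ≤ c :=
      Finset.single_le_sum (f := fun i => |form M (simpleRoot i) q / form M (simpleRoot i) p|)
        (fun _ _ => abs_nonneg _) (Finset.mem_univ i)
    have h1 := (neg_le_abs _).trans hle
    rw [← neg_div, div_le_iff₀ hpos] at h1
    linarith
  have h1 : q + c • p ∈ Submodule.span ℝ
      (closure (fundamentalChamber M) ∩ (edge cs K : Set (B → ℝ))) :=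
    Submodule.subset_span ⟨hmem, (edge cs K).add_mem hq ((edge cs K).smul_mem c hpE)⟩
  have h2 : p ∈ Submodule.span ℝ
      (closure (fundamentalChamber M) ∩ (edge cs K : Set (B → ℝ))) :=
    Submodule.subset_span ⟨(mem_closure_fundamentalChamber cs).mpr hp, hpE⟩
  simpa using Submodule.sub_mem _ h1 (Submodule.smul_mem _ c h2)

theorem span_closure_chamber_inter (x t : W) :
    Submodule.span ℝ (closure (chamber cs x) ∩ (hyperplane cs t : Set (B → ℝ))) =
      (edge cs (support cs (x * t * x⁻¹))).map (rep cs x⁻¹ : (B → ℝ) →ₗ[ℝ] (B → ℝ)) := by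
  rw [← span_closure_inter_edge cs (support_subset_simples cs _), ← closure_inter_hyperplane,
    Submodule.map_span, closure_chamber]
  congr 1
  ext p
  constructor
  · rintro ⟨⟨q, hq, rfl⟩, hp⟩
    refine ⟨q, ⟨hq, ?_⟩, rfl⟩
    rw [SetLike.mem_coe, mem_hyperplane] at hp ⊢
    rw [rep_mul, rep_mul, hp, rep_rep_inv]
  · rintro ⟨q, ⟨hq, hq'⟩, rfl⟩
    refine ⟨⟨q, hq, rfl⟩, ?_⟩
    rw [SetLike.mem_coe, mem_hyperplane] at hq' ⊢
    rw [rep_mul, rep_mul] at hq'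
    change rep cs t (rep cs x⁻¹ q) = rep cs x⁻¹ q
    conv_rhs => rw [← hq', rep_inv_rep]

/-- The subspace `E_K` and the subgroup `W_K` determine each other, as fixed space and pointwise
stabilizer. -/
theorem map_edge_eq_iff {J K : Set W} (hJ : J ⊆ simples cs) (hK : K ⊆ simples cs) (x : W) :
    (edge cs K).map (rep cs x⁻¹ : (B → ℝ) →ₗ[ℝ] (B → ℝ)) = edge cs J ↔
      ∀ g, x * g * x⁻¹ ∈ parabolic K ↔ g ∈ parabolic J := by
  have hmap : ∀ p, p ∈ (edge cs K).map (rep cs x⁻¹ : (B → ℝ) →ₗ[ℝ] (B → ℝ)) ↔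
      rep cs x p ∈ edge cs K := by
    intro p
    constructor
    · rintro ⟨q, hq, rfl⟩
      simpa [rep_rep_inv] using hq
    · exact fun h => ⟨_, h, rep_inv_rep cs x p⟩
  constructor
  · intro h g
    rw [mem_parabolic_iff cs hJ, mem_parabolic_iff cs hK, ← h]
    constructor
    · intro hg p hp
      have := hg _ ((hmap p).mp hp)
      rw [rep_mul, rep_mul, rep_inv_rep] at this
      exact (rep cs x).injective this
    · intro hg p hp
      rw [rep_mul, rep_mul, hg, rep_rep_inv]
      rw [hmap, rep_rep_inv]
      exact hp
  · intro h
    ext p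
    rw [hmap]
    constructor
    · intro hp
      rw [mem_edge]
      intro u hu
      have := rep_eq_self_of_mem_parabolic cs hp ((h u).mpr (Subgroup.subset_closure hu))
      rw [rep_mul, rep_mul, rep_inv_rep] at this
      exact (rep cs x).injective this
    · intro hp
      rw [mem_edge]
      intro u hu
      have hmem : x⁻¹ * u * x ∈ parabolic J := by
        rw [← h]
        simpa [mul_assoc] using show u ∈ parabolic K from Subgroup.subset_closure hu
      have := rep_eq_self_of_mem_parabolic cs hp hmem
      rw [rep_mul, rep_mul] at this
      conv_rhs => rw [← this, rep_rep_inv]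

theorem mem_chambersSpanning_iff {J : Set W} (hJ : J ⊆ simples cs) (t x : W) :
    x ∈ chambersSpanning cs (edge cs (reflectionsIn cs J)) t ↔
      ∀ g, x * g * x⁻¹ ∈ parabolic (support cs (x * t * x⁻¹)) ↔ g ∈ parabolic J := by
  rw [← map_edge_eq_iff cs hJ (support_subset_simples cs _), ← span_closure_chamber_inter,
    edge_reflectionsIn cs hJ]
  rfl

end Chambers

/-! ### Conjugating parabolic subgroups and supports -/

section Conjugation

variable {B : Type*} {M : CoxeterMatrix B} {W : Type*} [Group W] (cs : CoxeterSystem M W)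

theorem mem_conjSet {A : Set W} {w g : W} : g ∈ conjSet A w ↔ w * g * w⁻¹ ∈ A := by
  constructor
  · rintro ⟨a, ha, rfl⟩
    simpa [conj, mul_assoc] using ha
  · exact fun h => ⟨_, h, by simp [conj, mul_assoc]⟩

theorem conj_mem_parabolic {A A' : Set W} {w : W} (h : ∀ a ∈ A, w * a * w⁻¹ ∈ A') {g : W}
    (hg : g ∈ parabolic A) : w * g * w⁻¹ ∈ parabolic A' := by
  have hle : parabolic A ≤ (parabolic A').comap (MulAut.conj w).toMonoidHom :=
    (Subgroup.closure_le _).mpr fun a ha => Subgroup.subset_closure (h a ha)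
  exact hle hg

theorem conj_mem_parabolic_iff {K J : Set W} {w : W} (h : conjSet K w = J) (g : W) :
    w * g * w⁻¹ ∈ parabolic K ↔ g ∈ parabolic J := by
  subst h
  refine ⟨fun hg => ?_, fun hg => conj_mem_parabolic (fun a ha => mem_conjSet.mp ha) hg⟩
  have := conj_mem_parabolic (w := w⁻¹) (A' := conjSet K w)
    (fun a ha => mem_conjSet.mpr (by simpa [mul_assoc] using ha)) hg
  simpa [mul_assoc] using this

variable [Fintype B] [DecidableEq B]

theorem rep_conj_simple (w : W) (i : B) (x : B → ℝ) :
    rep cs (w * cs.simple i * w⁻¹) x =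
      x - (2 * form M (rep cs w (simpleRoot i)) x) • rep cs w (simpleRoot i) := by
  rw [rep_mul, rep_mul, rep_simple, map_sub, map_smul, rep_rep_inv, form_rep_left]

/-- If `w` conjugates `W_J` to `W_K` and has no descents in `J` on the right and in `K` on the
left, then it maps simple reflections in `J` to simple reflections in `K`. -/
theorem conj_simple_mem {J K : Set W} (hK : K ⊆ simples cs) {w : W}
    (hw : ∀ g ∈ parabolic J, w * g * w⁻¹ ∈ parabolic K)
    (hr : ∀ i, cs.simple i ∈ J → ¬ cs.IsRightDescent w i)
    (hl : ∀ k, cs.simple k ∈ K → ¬ cs.IsRightDescent w⁻¹ k) {i : B} (hi : cs.simple i ∈ J) :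
    w * cs.simple i * w⁻¹ ∈ K := by
  set b := rep cs w (simpleRoot i) with hb
  have hb0 : 0 ≤ b := rep_simpleRoot_nonneg cs (hr i hi)
  -- The reflection `w sᵢ w⁻¹` negates `b`, yet lies in `W_K` and so preserves the coordinates
  -- outside `K`.
  have hbK : ∀ k, cs.simple k ∉ K → b k = 0 := by
    intro k hk
    have h1 := rep_apply_of_notMem cs hK (hw _ (Subgroup.subset_closure hi)) hk b
    rw [rep_mul, rep_mul, hb, rep_inv_rep, rep_simple_self, map_neg, ← hb, Pi.neg_apply] at h1
    linarith
  obtain ⟨k, hk⟩ : ∃ k, b k ≠ 0 := by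
    by_contra! h
    refine simpleRoot_ne_zero i ((rep cs w).injective ?_)
    rw [← hb, map_zero]
    exact funext h
  have hkK : cs.simple k ∈ K := by
    by_contra h
    exact hk (hbK k h)
  -- This writes `αᵢ` as a nonnegative combination of nonnegative vectors `w⁻¹ αₖ`, so each one with
  -- `b k ≠ 0` is a multiple of `αᵢ`; invariance of the form makes the factor `1`.
  have hinv : simpleRoot i = ∑ k, b k • rep cs w⁻¹ (simpleRoot k) := by
    rw [← rep_inv_rep cs w (simpleRoot i), ← hb]
    conv_lhs => rw [eq_sum_smul_simpleRoot b]
    simp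
  have hterm : ∀ l k, 0 ≤ b k * rep cs w⁻¹ (simpleRoot k) l := by
    intro l k
    by_cases h : cs.simple k ∈ K
    · exact mul_nonneg (hb0 k) (rep_simpleRoot_nonneg cs (hl k h) l)
    · simp [hbK k h]
  have hzero : ∀ l, l ≠ i → rep cs w⁻¹ (simpleRoot k) l = 0 := by
    intro l hli
    have h1 := congrFun hinv l
    simp only [simpleRoot, Pi.single_apply, hli, if_false, Finset.sum_apply, Pi.smul_apply,
      smul_eq_mul] at h1
    have h2 := (Finset.sum_eq_zero_iff_of_nonneg fun k _ => hterm l k).mp h1.symm k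
      (Finset.mem_univ k)
    exact (mul_eq_zero.mp h2).resolve_left hk
  set c := rep cs w⁻¹ (simpleRoot k) i with hc
  have hck : rep cs w⁻¹ (simpleRoot k) = c • simpleRoot i := by
    ext l
    by_cases hli : l = i
    · subst hli; simp [simpleRoot, hc]
    · rw [hzero l hli]; simp [simpleRoot, hli]
  have hc0 : 0 ≤ c := rep_simpleRoot_nonneg cs (hl k hkK) i
  have hc1 : c = 1 := by
    have h1 := form_rep cs w⁻¹ (simpleRoot k) (simpleRoot k)
    rw [hck, form_self, map_smul, map_smul, LinearMap.smul_apply, form_self] at h1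
    simp only [smul_eq_mul, mul_one] at h1
    nlinarith
  have hbk : b = simpleRoot k := by
    rw [hb, ← one_smul ℝ (simpleRoot i), ← hc1, ← hck, rep_rep_inv]
  have : w * cs.simple i * w⁻¹ = cs.simple k := by
    refine rep_injective cs (LinearEquiv.ext fun x => ?_)
    rw [rep_conj_simple, ← hb, hbk, rep_simple]
  rwa [this]

/-- Take `w` shortest in `x W_J`. As `w W_J = W_K w`, it is shortest on both sides, so
`conj_simple_mem` applies to `w` and to `w⁻¹`. -/
theorem exists_minimal_conjugator {J K : Set W} (hJ : J ⊆ simples cs) (hK : K ⊆ simples cs)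
    {x : W} (hx : ∀ g, x * g * x⁻¹ ∈ parabolic K ↔ g ∈ parabolic J) :
    ∃ w y, y ∈ parabolic J ∧ x = w * y ∧ conjSet K w = J ∧
      w ∈ minReps cs K ∧ w⁻¹ ∈ minReps cs J := by
  obtain ⟨y, hy, hmin⟩ := exists_minimalFor_of_wellFoundedLT (fun y => y ∈ parabolic J)
    (fun y => cs.length (x * y)) ⟨1, one_mem _⟩
  set w := x * y with hw
  have hwmin : ∀ g ∈ parabolic J, cs.length w ≤ cs.length (w * g) := by
    intro g hg
    rw [hw, mul_assoc]
    exact (le_total _ _).elim id (hmin (mul_mem hy hg))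
  have hwx : ∀ g, w * g * w⁻¹ ∈ parabolic K ↔ g ∈ parabolic J := by
    intro g
    have : w * g * w⁻¹ = x * (y * g * y⁻¹) * x⁻¹ := by rw [hw]; group
    rw [this, hx, Subgroup.mul_mem_cancel_right _ (inv_mem hy), Subgroup.mul_mem_cancel_left _ hy]
  have hinv : ∀ g ∈ parabolic K, w⁻¹ * g * w ∈ parabolic J := fun g hg =>
    (hwx _).mp (by simpa [mul_assoc] using hg)
  have hKmin : w ∈ minReps cs K := by
    intro g hg
    have := hwmin _ (hinv g hg)
    simpa [mul_assoc] using this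
  have hJmin : w⁻¹ ∈ minReps cs J := by
    intro g hg
    have := hwmin _ (inv_mem hg)
    rw [← cs.length_inv w, ← cs.length_inv (w * g⁻¹)] at this
    simpa using this
  have hr : ∀ i, cs.simple i ∈ J → ¬ cs.IsRightDescent w i := fun i hi =>
    not_lt.mpr (hwmin _ (Subgroup.subset_closure hi))
  have hl : ∀ k, cs.simple k ∈ K → ¬ cs.IsRightDescent w⁻¹ k := fun k hk => by
    rw [cs.isRightDescent_inv_iff]
    exact not_lt.mpr (hKmin _ (Subgroup.subset_closure hk))
  refine ⟨w, y⁻¹, inv_mem hy, by rw [hw]; group, ?_, hKmin, hJmin⟩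
  ext g
  rw [mem_conjSet]
  constructor
  · intro hg
    obtain ⟨k, hk⟩ := hK hg
    have := conj_simple_mem cs (w := w⁻¹) (J := K) hJ
      (fun g hg => by simpa using hinv g hg) hl (by simpa using hr) (i := k) (hk ▸ hg)
    rw [hk] at this
    simpa [mul_assoc] using this
  · intro hg
    obtain ⟨i, rfl⟩ := hJ hg
    exact conj_simple_mem cs hK (fun g hg => (hwx g).mpr hg) hr hl hg

variable [Finite W]

/-- The support is the least set of simple reflections whose parabolic subgroup contains the
element, and conjugation by `c` matches subsets of `K` with subsets of `J`. -/
theorem support_conj {J K : Set W} (hJ : J ⊆ simples cs) (hK : K ⊆ simples cs) {c : W}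
    (hc : conjSet K c = J) {y : W} (hy : y ∈ parabolic J) :
    conjSet (support cs (c * y * c⁻¹)) c = support cs y := by
  have hsub : support cs y ⊆ J := (support_subset_iff cs hJ).mpr hy
  have hsub' : support cs (c * y * c⁻¹) ⊆ K :=
    (support_subset_iff cs hK).mpr ((conj_mem_parabolic_iff hc y).mpr hy)
  have hJK : conjSet (support cs (c * y * c⁻¹)) c ⊆ J := by
    rw [← hc]
    exact Set.image_mono hsub'
  have hKJ : conjSet (support cs y) c⁻¹ ⊆ K := by
    intro g hg
    rw [mem_conjSet] at hg
    have := hsub hg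
    rw [← hc, mem_conjSet] at this
    simpa [mul_assoc] using this
  refine subset_antisymm ?_ ?_
  · have h1 : support cs (c * y * c⁻¹) ⊆ conjSet (support cs y) c⁻¹ := by
      rw [support_subset_iff cs (hKJ.trans hK)]
      exact conj_mem_parabolic (fun a ha => mem_conjSet.mpr (by simpa [mul_assoc] using ha))
        (mem_parabolic_support cs y)
    intro g hg
    have := h1 (mem_conjSet.mp hg)
    rw [mem_conjSet] at this
    simpa [mul_assoc] using this
  · rw [support_subset_iff cs (hJK.trans hJ), ← conj_mem_parabolic_iff rfl]
    exact mem_parabolic_support cs _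

theorem support_conj_eq_iff {J K : Set W} (hJ : J ⊆ simples cs) (hK : K ⊆ simples cs) {c : W}
    (hc : conjSet K c = J) {y : W} (hy : y ∈ parabolic J) :
    support cs (c * y * c⁻¹) = K ↔ support cs y = J := by
  rw [← support_conj cs hJ hK hc hy]
  constructor
  · intro h
    rw [h, hc]
  · intro h
    ext g
    have : c⁻¹ * g * c ∈ conjSet (support cs (c * y * c⁻¹)) c ↔ c⁻¹ * g * c ∈ conjSet K c := by
      rw [h, hc]
    simpa [mem_conjSet, mul_assoc] using this

end Conjugation

/-! ### The centralizer of a reflection -/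

section Centralizer

variable {B : Type*} {M : CoxeterMatrix B} {W : Type*} [Group W] (cs : CoxeterSystem M W)

theorem mem_parabolic_simple {i : B} {g : W} :
    g ∈ parabolic {cs.simple i} ↔ g = 1 ∨ g = cs.simple i := by
  constructor
  · intro h
    induction h using Subgroup.closure_induction with
    | mem x hx => exact Or.inr hx
    | one => exact Or.inl rfl
    | mul x y _ _ hx hy =>
      rcases hx with rfl | rfl <;> rcases hy with rfl | rfl <;> simp
    | inv x _ hx => rcases hx with rfl | rfl <;> simp
  · rintro (rfl | rfl)
    · exact one_mem _
    · exact Subgroup.subset_closure rfl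

/-- Normalizing a group of order two means centralizing its generator. -/
theorem mem_normalizer_parabolic_simple {i : B} {g : W} :
    g ∈ Subgroup.normalizer (parabolic {cs.simple i} : Set W) ↔
      g * cs.simple i * g⁻¹ = cs.simple i := by
  have hne : cs.simple i ≠ 1 := by
    intro h
    simpa [h] using cs.length_simple i
  rw [Subgroup.mem_normalizer_iff]
  simp only [mem_parabolic_simple]
  constructor
  · intro h
    refine ((h (cs.simple i)).mp (Or.inr rfl)).resolve_left fun h1 => hne ?_
    simpa [mul_inv_eq_one] using h1
  · intro h k
    rw [conj_eq_one_iff]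
    refine or_congr_right ⟨fun hk => by rw [hk, h], fun hk => ?_⟩
    rw [← h] at hk
    simpa using hk

theorem mem_conjSet_normalizerIn {J : Set W} {t v : W} {i : B} (hv : v ∈ parabolic J)
    (ht : t = v⁻¹ * cs.simple i * v) {g : W} :
    g ∈ conjSet (normalizerIn (parabolic J) (parabolic {cs.simple i})) v ↔
      g ∈ parabolic J ∧ g * t * g⁻¹ = t := by
  rw [mem_conjSet]
  refine and_congr ?_ ?_
  · rw [Subgroup.mul_mem_cancel_right _ (inv_mem hv), Subgroup.mul_mem_cancel_left _ hv]
  · rw [mem_normalizer_parabolic_simple, ht]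
    constructor <;> intro h
    · calc g * (v⁻¹ * cs.simple i * v) * g⁻¹
          = v⁻¹ * (v * g * v⁻¹ * cs.simple i * (v * g * v⁻¹)⁻¹) * v := by group
        _ = _ := by rw [h]
    · calc v * g * v⁻¹ * cs.simple i * (v * g * v⁻¹)⁻¹
          = v * (g * (v⁻¹ * cs.simple i * v) * g⁻¹) * v⁻¹ := by group
        _ = _ := by rw [h]; group

theorem IsReducedConjExpr.mem_support {t v : W} {i : B} (h : IsReducedConjExpr cs t i v) :
    v ∈ parabolic (support cs t) ∧ t = v⁻¹ * cs.simple i * v := by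
  obtain ⟨ω, rfl, hred, rfl⟩ := h
  constructor
  · rw [CoxeterSystem.wordProd]
    refine Subgroup.list_prod_mem _ fun a ha => Subgroup.subset_closure ?_
    obtain ⟨j, hj, rfl⟩ := List.mem_map.mp ha
    exact ⟨_, hred, rfl, j, by simp [hj], rfl⟩
  · rw [cs.wordProd_append, cs.wordProd_reverse, cs.wordProd_cons, mul_assoc]

end Centralizer

end CoxArr

end

/-! ### The decomposition -/

open CoxArr in
theorem proposition2 {B W : Type*} [Fintype B] [DecidableEq B] [Group W] [Finite W]
    {M : CoxeterMatrix B} (cs : CoxeterSystem M W)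
    (J : Set W) (hJS : J ⊆ CoxArr.simples cs) (hJ : CoxArr.IsIrreducible J)
    (t : W) (ht : cs.IsReflection t) (htJ : CoxArr.support cs t = J)
    (i : B) (v : W) (hv : CoxArr.IsReducedConjExpr cs t i v)
    (c : Set W → W) (hc : ∀ K ∈ CoxArr.coxeterClass cs J, CoxArr.conjSet K (c K) = J)
    (d : W → W) (hd : ∀ u ∈ CoxArr.sameSupportConj cs t,
      d u ∈ CoxArr.parabolic J ∧ CoxArr.conj u (d u) = t) :
    let N : Set W := CoxArr.conjSet
      (CoxArr.normalizerIn (CoxArr.parabolic J) (CoxArr.parabolic {cs.simple i})) v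
    let D : Set W := ⋃ u ∈ CoxArr.sameSupportConj cs t, d u • N
    let X : Set W := CoxArr.doubleReps cs (CoxArr.simples cs) J
    CoxArr.chambersSpanning cs (CoxArr.edge cs (CoxArr.reflectionsIn cs J)) t =
        (⋃ K ∈ CoxArr.coxeterClass cs J, c K • (X * D)) ∧
      (CoxArr.coxeterClass cs J).PairwiseDisjoint (fun K => c K • (X * D)) ∧
      (CoxArr.sameSupportConj cs t).PairwiseDisjoint (fun u => d u • N) := by
  intro N D X
  have htW : t ∈ parabolic J := htJ ▸ mem_parabolic_support cs t
  obtain ⟨hvJ, htv⟩ := hv.mem_support cs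
  rw [htJ] at hvJ
  -- Each inner piece is the full set of `y` in `W_J` carrying `t` to `u`, a left coset of the
  -- centralizer of `t` in `W_J`.
  have hN : ∀ u ∈ sameSupportConj cs t, ∀ y, y ∈ d u • N ↔
      y ∈ parabolic J ∧ y * t * y⁻¹ = u := by
    intro u hu y
    obtain ⟨hdu, hut⟩ := hd u hu
    have hut' : u = d u * t * (d u)⁻¹ := by rw [← hut, conj]; group
    rw [Set.mem_smul_set_iff_inv_smul_mem, smul_eq_mul, mem_conjSet_normalizerIn cs hvJ htv,
      Subgroup.mul_mem_cancel_left _ (inv_mem hdu)]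
    refine and_congr_right fun _ => ?_
    constructor <;> intro h
    · rw [hut']
      nth_rewrite 2 [← h]
      group
    · calc (d u)⁻¹ * y * t * ((d u)⁻¹ * y)⁻¹ = (d u)⁻¹ * (y * t * y⁻¹) * d u := by group
        _ = t := by rw [h]; exact hut
  have hD : ∀ y, y ∈ D ↔ y ∈ parabolic J ∧ support cs (y * t * y⁻¹) = J := by
    intro y
    simp only [D, Set.mem_iUnion, exists_prop]
    constructor
    · rintro ⟨u, hu, hy⟩
      obtain ⟨hyJ, rfl⟩ := (hN u hu y).mp hy
      exact ⟨hyJ, hu.1.trans htJ⟩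
    · rintro ⟨hyJ, hy⟩
      have hu : y * t * y⁻¹ ∈ sameSupportConj cs t :=
        ⟨hy.trans htJ.symm, (isConj_iff.mpr ⟨y, rfl⟩ : IsConj t _).symm⟩
      exact ⟨_, hu, (hN _ hu y).mpr ⟨hyJ, rfl⟩⟩
  have hconj : ∀ y ∈ parabolic J, y * t * y⁻¹ ∈ parabolic J := fun y hy =>
    mul_mem (mul_mem hy htW) (inv_mem hy)
  -- This intrinsic description of the outer pieces does not involve `c K`; it recovers `K` from
  -- `x`, which gives disjointness.
  have hXD : ∀ K ∈ coxeterClass cs J, ∀ x, x ∈ c K • (X * D) ↔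
      (∀ g, x * g * x⁻¹ ∈ parabolic K ↔ g ∈ parabolic J) ∧ support cs (x * t * x⁻¹) = K := by
    intro K hK x
    constructor
    · rintro ⟨_, ⟨w, hw, y, hy, rfl⟩, rfl⟩
      obtain ⟨hyJ, hys⟩ := (hD y).mp hy
      have e : ∀ g, (c K • (w * y)) * g * (c K • (w * y))⁻¹ =
          c K * (w * (y * g * y⁻¹) * w⁻¹) * (c K)⁻¹ := fun g => by
        rw [smul_eq_mul]; group
      constructor
      · intro g
        simp only [e]
        rw [conj_mem_parabolic_iff (hc K hK), conj_mem_parabolic_iff hw.2.2.2,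
          Subgroup.mul_mem_cancel_right _ (inv_mem hyJ), Subgroup.mul_mem_cancel_left _ hyJ]
      · simp only [e]
        rw [support_conj_eq_iff cs hJS hK.1 (hc K hK)
          ((conj_mem_parabolic_iff hw.2.2.2 _).mpr (hconj y hyJ)),
          support_conj_eq_iff cs hJS hJS hw.2.2.2 (hconj y hyJ)]
        exact hys
    · rintro ⟨hx, hs⟩
      -- Once `c K` is removed, the element normalizes `W_J`, so it can be factored with `K`
      -- replaced by `J`.
      have hz : ∀ g, (c K)⁻¹ * x * g * ((c K)⁻¹ * x)⁻¹ ∈ parabolic J ↔ g ∈ parabolic J := by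
        intro g
        rw [← conj_mem_parabolic_iff (hc K hK), ← hx]
        simp [mul_assoc]
      obtain ⟨w, y, hy, hwy, hwJ, hw1, hw2⟩ := exists_minimal_conjugator cs hJS hJS hz
      have hxe : x = c K * (w * y) := by rw [← hwy]; group
      refine ⟨w * y, ⟨w, ⟨?_, hw1, hw2, hwJ⟩, y, (hD y).mpr ⟨hy, ?_⟩, rfl⟩, hxe.symm⟩
      · rw [parabolic, simples, cs.subgroup_closure_range_simple]
        exact Subgroup.mem_top w
      · rw [← support_conj_eq_iff cs hJS hJS hwJ (hconj y hy),
          ← support_conj_eq_iff cs hJS hK.1 (hc K hK)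
            ((conj_mem_parabolic_iff hwJ _).mpr (hconj y hy))]
        convert hs using 2
        rw [hxe]
        group
  refine ⟨?_, ?_, ?_⟩
  · ext x
    rw [mem_chambersSpanning_iff cs hJS]
    simp only [Set.mem_iUnion, exists_prop]
    constructor
    · intro hx
      have hKS := support_subset_simples cs (x * t * x⁻¹)
      obtain ⟨w, -, -, -, hw, -⟩ := exists_minimal_conjugator cs hJS hKS hx
      exact ⟨_, ⟨hKS, w, hw⟩, (hXD _ ⟨hKS, w, hw⟩ x).mpr ⟨hx, rfl⟩⟩
    · rintro ⟨K, hK, hx⟩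
      obtain ⟨h, rfl⟩ := (hXD K hK x).mp hx
      exact h
  · intro K hK K' hK' hne
    refine Set.disjoint_left.mpr fun x hx hx' => hne ?_
    rw [← ((hXD K hK x).mp hx).2, ((hXD K' hK' x).mp hx').2]
  · intro u hu u' hu' hne
    refine Set.disjoint_left.mpr fun y hy hy' => hne ?_
    rw [← ((hN u hu y).mp hy).2, ((hN u' hu' y).mp hy').2]
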